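/- A digraph here has no loops and no pair of opposite arcs (if $x\to y$ is an arc, then $y\to x$ is not). Its chromatic number is that of its underlying undirected graph, and it is $n$-chromatic if this number equals $n$. It is strongly connected if for any two vertices $x,y$ there is a directed path from $x$ to $y$. For integers $k,l\ge 0$ let $P(k,l)$ be the digraph with distinct vertices $x_0,x_1,\dots,x_{k+l}$ and with exactly the arcs $x_{i}\to x_{i+1}$ for $0\le i<k$ and $x_{i+1}\to x_{i}$ for $k\le i<k+l$; for $k,l\ge 1$ this is the oriented path with two blocks, of lengths $k$ and $l$, and if $k$ or $l$ is $0$ it is a directed path. Let $n\ge 4$, let $k,l\ge 0$ be integers with $k+l=n-1$, and let $D$ be a (finite or infinite) strongly connected $n$-chromatic digraph. Then $D$ contains $P(k,l)$ as a (not necessarily induced) subdigraph. -/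

import Mathlib

namespace Digraph

/-- The digraphs considered here are oriented graphs: `x → y` excludes `y → x`; taking `x = y`,
there are no loops. -/
def IsOriented {V : Type*} (D : Digraph V) : Prop :=
  ∀ x y : V, D.Adj x y → ¬ D.Adj y x

/-- For any two vertices `x`, `y` there is a directed path from `x` to `y` (the pair `(y, x)`
gives the path back). `Relation.ReflTransGen` is reachability along finitely many arcs, possibly
none; a directed walk from `x` to `y` always contains a directed path with distinct vertices. -/
def IsStronglyConnected {V : Type*} (D : Digraph V) : Prop :=
  ∀ x y : V, Relation.ReflTransGen D.Adj x y

/-- The chromatic number of a digraph is that of its underlying graph, in which two distinct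
vertices are adjacent when there is an arc between them in some direction. It is `⊤` when no
finite number of colours suffices. -/
noncomputable def chromaticNumber {V : Type*} (D : Digraph V) : ℕ∞ :=
  D.toSimpleGraphInclusive.chromaticNumber

/-- `D` contains (a copy of) `H`: there is an injective morphism of digraphs from `H` to `D`.
The copy need not be an induced subdigraph. -/
def Contains {V W : Type*} (D : Digraph V) (H : Digraph W) : Prop :=
  ∃ f : W → V, Function.Injective f ∧ ∀ x y : W, H.Adj x y → D.Adj (f x) (f y)

/-- The path `P(k, l)` with two blocks, on the vertices `0, 1, …, k + l`: the first block is
`0 → 1 → ⋯ → k`, of length `k`, the second one is `k ← k + 1 ← ⋯ ← k + l`, of length `l`. -/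
def twoBlockPath (k l : ℕ) : Digraph (Fin (k + l + 1)) where
  Adj i j := ((i : ℕ) + 1 = j ∧ (j : ℕ) ≤ k) ∨ ((j : ℕ) + 1 = i ∧ k ≤ (j : ℕ))

end Digraph

/-! A graph is `m`-colourable once its finite subgraphs are, and in a strongly connected digraph
finite vertex sets lie in finite strongly connected ones, so `D` may be taken finite and not `(k +
l)`-colourable. Reversing the path lets `k` be the longer block, so `k ≥ 2`.

Some directed circuit `C` has more than `k` vertices and induces a `(k + 1)`-colourable subdigraph
(`exists_isCircuit_colorableOn`). Hence the rest of `D` is not `(l - 1)`-colourable, which forces a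
path of length `l` meeting `C` only in its end `s` (`exists_path_or_colorableOn`; `l = 0` is
trivial). The `k` arcs of `C` leading to `s` form the other block.

`C` is a shortest circuit among those with more than `k` vertices. It exists because a digraph whose
arcs all lie on circuits, none of length `1` modulo `k`, is `k`-colourable
(`colorableOn_univ_of_not_dvd`): take a potential, modulo `k`, for arc weights `1 - k * w` with `w`
minimal. The path comes from an in-forest rooted at `C` with maximal sum of levels. -/

namespace Digraph

variable {V : Type*}

/-! ### Weights of walks, circuits and potentials -/

/-- The sum of the weights `g x y` over the consecutive pairs `x, y` of a list. -/
def walkWeight (g : V → V → ℤ) : List V → ℤ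
  | [] => 0
  | [_] => 0
  | x :: y :: p => g x y + walkWeight g (y :: p)

theorem walkWeight_append (g : V → V → ℤ) (s : List V) (v : V) (t : List V) :
    walkWeight g (s ++ v :: t) = walkWeight g (s ++ [v]) + walkWeight g (v :: t) := by
  induction s with
  | nil => simp [walkWeight]
  | cons x s ih =>
    cases s with
    | nil => simp [walkWeight]
    | cons y s => simp only [List.cons_append, walkWeight] at ih ⊢; rw [ih]; ring

theorem walkWeight_congr {g g' : V → V → ℤ} (p : List V) (z : V)
    (h : ∀ x ∈ p, ∀ y, g x y = g' x y) :
    walkWeight g (p ++ [z]) = walkWeight g' (p ++ [z]) := by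
  induction p with
  | nil => simp [walkWeight]
  | cons x p ih =>
    have ih := ih fun a ha => h a (List.mem_cons_of_mem _ ha)
    have hx := h x List.mem_cons_self
    cases p with
    | nil => simp [walkWeight, hx]
    | cons y p => simp only [List.cons_append, walkWeight] at ih ⊢; rw [ih, hx]

theorem walkWeight_mono {g g' : V → V → ℤ} (h : ∀ x y, g x y ≤ g' x y) :
    ∀ p : List V, walkWeight g p ≤ walkWeight g' p
  | [] => le_rfl
  | [_] => le_rfl
  | x :: y :: p => add_le_add (h x y) (walkWeight_mono h (y :: p))

theorem walkWeight_one_sub (k : ℤ) (w : V → V → ℤ) (v : V) (p : List V) :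
    walkWeight (fun x y => 1 - k * w x y) (v :: p) = p.length - k * walkWeight w (v :: p) := by
  induction p generalizing v with
  | nil => simp [walkWeight]
  | cons x p ih => simp only [walkWeight, ih, List.length_cons]; push_cast; ring

theorem add_walkWeight_le {r : V → V → Prop} {g : V → V → ℤ} {f : V → ℤ}
    (hf : ∀ u v, r u v → f u + g u v ≤ f v) (v u : V) (p : List V)
    (hp : List.IsChain r (v :: p)) (hu : (v :: p).getLast? = some u) :
    f v + walkWeight g (v :: p) ≤ f u := by
  induction p generalizing v with
  | nil => simp_all [walkWeight]
  | cons x p ih =>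
    rw [List.isChain_cons_cons] at hp
    have h1 := ih x hp.2 (by simpa using hu)
    have h2 := hf v x hp.1
    simp only [walkWeight]
    linarith

/-- `u → t₁ → ⋯ → tₘ → u` is a directed circuit without repeated vertices; its length is
`t.length + 1`. -/
def IsCircuit (r : V → V → Prop) (u : V) (t : List V) : Prop :=
  (u :: t).Nodup ∧ List.IsChain r (u :: t ++ [u])

theorem IsCircuit.rotate {r : V → V → Prop} {u x : V} {a b : List V}
    (h : IsCircuit r u (a ++ x :: b)) : IsCircuit r x (b ++ u :: a) := by
  obtain ⟨h1, h2⟩ := h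
  constructor
  · refine (List.Perm.nodup_iff ?_).1 h1
    rw [← List.cons_append, ← List.cons_append]
    exact List.perm_append_comm
  · have e1 : u :: (a ++ x :: b) ++ [u] = (u :: a) ++ x :: (b ++ [u]) := by simp
    have e2 : x :: (b ++ u :: a) ++ [x] = (x :: b) ++ u :: (a ++ [x]) := by simp
    rw [e1, List.isChain_split] at h2
    rw [e2, List.isChain_split]
    exact ⟨by simpa using h2.2, by simpa using h2.1⟩

theorem walkWeight_rotate (g : V → V → ℤ) (u x : V) (a b : List V) :
    walkWeight g (x :: (b ++ u :: a) ++ [x]) = walkWeight g (u :: (a ++ x :: b) ++ [u]) := by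
  have e1 : u :: (a ++ x :: b) ++ [u] = (u :: a) ++ x :: (b ++ [u]) := by simp
  have e2 : x :: (b ++ u :: a) ++ [x] = (x :: b) ++ u :: (a ++ [x]) := by simp
  rw [e1, e2, walkWeight_append, walkWeight_append g (u :: a)]
  simp only [List.cons_append]
  ring

/-- If no directed circuit has positive weight, there is a potential. -/
theorem exists_potential [Finite V] {r : V → V → Prop} {g : V → V → ℤ}
    (h : ∀ u t, IsCircuit r u t → walkWeight g (u :: t ++ [u]) ≤ 0) :
    ∃ f : V → ℤ, ∀ u v, r u v → f u + g u v ≤ f v := by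
  classical
  have := Fintype.ofFinite V
  have hfin : {l : List V | l.Nodup}.Finite :=
    Set.finite_coe_iff.1 (inferInstanceAs (Finite {l : List V // l.Nodup}))
  -- The potential of `u` is the largest weight of a simple path ending at `u`.
  have hmax (u : V) : ∃ p : List V, ((p ++ [u]).Nodup ∧ List.IsChain r (p ++ [u])) ∧
      ∀ q : List V, ((q ++ [u]).Nodup ∧ List.IsChain r (q ++ [u])) →
        walkWeight g (q ++ [u]) ≤ walkWeight g (p ++ [u]) := by
    have hf : {p : List V | (p ++ [u]).Nodup ∧ List.IsChain r (p ++ [u])}.Finite :=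
      hfin.subset fun p hp => (List.nodup_append.1 hp.1).1
    obtain ⟨p, hp, hq⟩ := Set.exists_max_image _ (fun p => walkWeight g (p ++ [u])) hf
      ⟨[], by simp⟩
    exact ⟨p, hp, hq⟩
  choose P hP hmax using hmax
  refine ⟨fun u => walkWeight g (P u ++ [u]), fun u v huv => ?_⟩
  obtain ⟨hnd, hch⟩ := hP u
  have hw : walkWeight g (P u ++ [u] ++ [v]) = walkWeight g (P u ++ [u]) + g u v := by
    have := walkWeight_append g (P u) u [v]
    simpa [walkWeight] using this
  have hch' : List.IsChain r (P u ++ [u] ++ [v]) := by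
    have e : P u ++ [u] ++ [v] = P u ++ u :: [v] := by simp
    rw [e, List.isChain_split]
    exact ⟨hch, by simpa using huv⟩
  show _ + _ ≤ _
  rw [← hw]
  -- If `v` is already on the path, the part from `v` on closes to a circuit of weight at most `0`;
  -- cutting it off leaves a path to `v` that is at least as heavy.
  by_cases hv : v ∈ P u ++ [u]
  · obtain ⟨s, t, hst⟩ := List.append_of_mem hv
    rw [hst] at hnd hch' ⊢
    have e : s ++ v :: t ++ [v] = s ++ v :: (t ++ [v]) := by simp
    rw [e] at hch' ⊢
    rw [List.isChain_split] at hch'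
    rw [walkWeight_append]
    have h1 := h v t ⟨(List.nodup_append.1 hnd).2.1, by simpa using hch'.2⟩
    have h2 := hmax v s ⟨?_, hch'.1⟩
    · simp only [List.cons_append] at h1
      linarith
    · exact hnd.sublist (by simp)
  · refine hmax v (P u ++ [u]) ⟨?_, hch'⟩
    simpa [List.concat_eq_append] using hnd.concat hv

/-! ### Minimal integer weights with `|C| ≤ k * w(C)` on all circuits -/

theorem exists_nodup_isChain {r : V → V → Prop} {a b : V} (h : Relation.ReflTransGen r a b) :
    ∃ p : List V, (p ++ [b]).Nodup ∧ List.IsChain r (p ++ [b]) ∧ (p ++ [b]).head? = some a := by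
  classical
  induction h using Relation.ReflTransGen.head_induction_on with
  | refl => exact ⟨[], by simp⟩
  | @head a c hac _ ih =>
    obtain ⟨p, h1, h2, h3⟩ := ih
    by_cases ha : a ∈ p ++ [b]
    · rw [List.mem_append] at ha
      by_cases hb : a = b
      · exact ⟨[], by simp [hb]⟩
      · obtain ⟨s, t, rfl⟩ := List.append_of_mem (ha.resolve_right (by simpa using hb))
        refine ⟨a :: t, h1.sublist (by simp), h2.suffix ⟨s, by simp⟩, by simp⟩
    · refine ⟨a :: p, ?_, ?_, by simp⟩
      · simpa using ⟨by simpa using ha, h1⟩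
      · rw [List.cons_append, List.isChain_cons]
        refine ⟨fun y hy => ?_, h2⟩
        rw [h3] at hy
        simp only [Option.mem_def, Option.some.injEq] at hy
        exact hy ▸ hac

/-- The `head?` condition makes `u → v` the first arc of the circuit; appending `u` covers the case
of empty `t`. -/
theorem exists_isCircuit {r : V → V → Prop} {u v : V} (huv : r u v)
    (h : Relation.ReflTransGen r v u) :
    ∃ t, IsCircuit r u t ∧ (t ++ [u]).head? = some v := by
  obtain ⟨p, h1, h2, h3⟩ := exists_nodup_isChain h
  refine ⟨p, ⟨(List.Perm.nodup_iff ?_).1 h1, ?_⟩, h3⟩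
  · exact List.perm_append_singleton u p
  · rw [List.cons_append, List.isChain_cons]
    refine ⟨fun y hy => ?_, h2⟩
    rw [h3] at hy
    simp only [Option.mem_def, Option.some.injEq] at hy
    exact hy ▸ huv

/-- Every directed circuit `C` satisfies `|C| ≤ k * w(C)`. -/
def IsFeasible (r : V → V → Prop) (k : ℕ) (w : V → V → ℤ) : Prop :=
  ∀ u t, IsCircuit r u t → (t.length + 1 : ℤ) ≤ k * walkWeight w (u :: t ++ [u])

/-- The arc from `u` to `v` lies on a directed circuit `C` with `|C| > k * (w(C) - 1)`. -/
def IsTight (r : V → V → Prop) (k : ℕ) (w : V → V → ℤ) (u v : V) : Prop :=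
  ∃ t, IsCircuit r u t ∧ (t ++ [u]).head? = some v ∧
    k * (walkWeight w (u :: t ++ [u]) - 1) < (t.length + 1 : ℤ)

/-- Thus an arc once made tight stays so while other arcs are lowered. -/
theorem IsTight.anti {r : V → V → Prop} {k : ℕ} {w w' : V → V → ℤ} (h : ∀ x y, w' x y ≤ w x y)
    {u v : V} (ht : IsTight r k w u v) : IsTight r k w' u v := by
  obtain ⟨t, h1, h2, h3⟩ := ht
  refine ⟨t, h1, h2, lt_of_le_of_lt ?_ h3⟩
  have := walkWeight_mono h (u :: t ++ [u])
  gcongr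

open Classical in
/-- Decrease the weight of the single arc from `u` to `v` by `j`. -/
noncomputable def lowerAt (w : V → V → ℤ) (u v : V) (j : ℤ) (x y : V) : ℤ :=
  w x y - if x = u ∧ y = v then j else 0

theorem lowerAt_self (w : V → V → ℤ) (u v : V) (j : ℤ) : lowerAt w u v j u v = w u v - j := by
  simp [lowerAt]

/-- A circuit leaves `u` only once, namely towards `y`, so no other term can change. -/
theorem walkWeight_lowerAt {w : V → V → ℤ} {u v y : V} {j : ℤ} {t : List V}
    (ht : (u :: t).Nodup) (hy : (t ++ [u]).head? = some y) :
    walkWeight (lowerAt w u v j) (u :: t ++ [u]) =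
      walkWeight w (u :: t ++ [u]) - (w u y - lowerAt w u v j u y) := by
  have h : walkWeight (lowerAt w u v j) (t ++ [u]) = walkWeight w (t ++ [u]) :=
    walkWeight_congr t u fun x hx y => by
      have : x ≠ u := fun h => (List.nodup_cons.1 ht).1 (h ▸ hx)
      simp [lowerAt, this]
  obtain ⟨q, hq⟩ := List.head?_eq_some_iff.1 hy
  rw [List.cons_append]
  rw [hq] at h ⊢
  simp only [walkWeight, h]
  ring

/-- A circuit whose weight changes passes through the lowered arc. -/
theorem exists_of_not_isFeasible_lowerAt {r : V → V → Prop} {k : ℕ} {w : V → V → ℤ} {u v : V}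
    {j : ℤ} (hw : IsFeasible r k w) (h : ¬ IsFeasible r k (lowerAt w u v j)) :
    ∃ t, IsCircuit r u t ∧ (t ++ [u]).head? = some v ∧
      k * (walkWeight w (u :: t ++ [u]) - j) < (t.length + 1 : ℤ) := by
  simp only [IsFeasible, not_forall, not_le] at h
  obtain ⟨x, s, hs, hlt⟩ := h
  have key : ∀ t, IsCircuit r u t →
      k * walkWeight (lowerAt w u v j) (u :: t ++ [u]) < (t.length + 1 : ℤ) →
      ∃ t, IsCircuit r u t ∧ (t ++ [u]).head? = some v ∧
      k * (walkWeight w (u :: t ++ [u]) - j) < (t.length + 1 : ℤ) := by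
    intro t ht hlt
    obtain ⟨y, hy⟩ : ∃ y, (t ++ [u]).head? = some y := by cases t <;> simp
    by_cases hyv : y = v
    · subst hyv
      rw [walkWeight_lowerAt ht.1 hy, lowerAt_self, sub_sub_cancel] at hlt
      exact ⟨t, ht, hy, hlt⟩
    · have h0 : lowerAt w u v j u y = w u y := by simp [lowerAt, hyv]
      rw [walkWeight_lowerAt ht.1 hy, h0, sub_self, sub_zero] at hlt
      exact absurd (hw u t ht) (not_le.2 hlt)
  by_cases hu : u ∈ x :: s
  · rw [List.mem_cons] at hu
    obtain rfl | hu := hu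
    · exact key s hs hlt
    · obtain ⟨a, b, rfl⟩ := List.append_of_mem hu
      refine key _ hs.rotate ?_
      have e : (b ++ x :: a).length = (a ++ u :: b).length := by
        simp only [List.length_append, List.length_cons]
        omega
      rwa [walkWeight_rotate, e]
  · rw [walkWeight_congr (g' := w)] at hlt
    · exact absurd (hw x s hs) (not_le.2 hlt)
    · intro y hy z
      have : y ≠ u := fun h => hu (h ▸ hy)
      simp [lowerAt, this]

/-- Lower the arc as far as feasibility permits: the circuit violated by one further unit witnesses
tightness. -/
theorem IsFeasible.exists_isTight {r : V → V → Prop} {k : ℕ} (hk : 0 < k) {w : V → V → ℤ}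
    (hw : IsFeasible r k w) {u v : V} (huv : r u v) (hvu : Relation.ReflTransGen r v u) :
    ∃ w', IsFeasible r k w' ∧ (∀ x y, w' x y ≤ w x y) ∧ IsTight r k w' u v := by
  classical
  have h0 : lowerAt w u v 0 = w := by ext; simp [lowerAt]
  have hex : ∃ j : ℕ, ¬ IsFeasible r k (lowerAt w u v (j + 1 : ℕ)) := by
    obtain ⟨t, ht, hv⟩ := exists_isCircuit huv hvu
    -- Lowering by more than the weight of one circuit through the arc makes that weight
    -- nonpositive, which is infeasible.
    refine ⟨(walkWeight w (u :: t ++ [u])).toNat, fun h => ?_⟩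
    have := h u t ht
    rw [walkWeight_lowerAt ht.1 hv, lowerAt_self, sub_sub_cancel] at this
    have h2 : walkWeight w (u :: t ++ [u])
        - ((walkWeight w (u :: t ++ [u])).toNat + 1 : ℕ) ≤ 0 := by
      push_cast
      have := Int.self_le_toNat (walkWeight w (u :: t ++ [u]))
      linarith
    have hk' : (0 : ℤ) ≤ k := by positivity
    have := mul_nonpos_of_nonneg_of_nonpos hk' h2
    linarith [(Nat.cast_nonneg t.length : (0 : ℤ) ≤ t.length)]
  have hj := Nat.find_spec hex
  have hmin := fun m => Nat.find_min hex (m := m)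
  generalize Nat.find hex = j at hj hmin
  have hf : IsFeasible r k (lowerAt w u v j) := by
    cases j with
    | zero => simpa [h0] using hw
    | succ j => exact not_not.1 (hmin j (Nat.lt_succ_self j))
  refine ⟨lowerAt w u v j, hf, fun x y => ?_, ?_⟩
  · unfold lowerAt
    split_ifs <;> simp
  · obtain ⟨t, h1, h2, h3⟩ := exists_of_not_isFeasible_lowerAt hw hj
    refine ⟨t, h1, h2, ?_⟩
    rw [walkWeight_lowerAt h1.1 h2, lowerAt_self, sub_sub_cancel]
    push_cast at h3
    linarith

theorem exists_isFeasible_forall_isTight [Finite V] {r : V → V → Prop} {k : ℕ} (hk : 0 < k)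
    (hr : ∀ u v, r u v → Relation.ReflTransGen r v u) :
    ∃ w : V → V → ℤ, IsFeasible r k w ∧ ∀ u v, r u v → IsTight r k w u v := by
  classical
  have := Fintype.ofFinite V
  suffices h : ∀ A : Finset (V × V), ∃ w : V → V → ℤ, IsFeasible r k w ∧
      ∀ u v, (u, v) ∈ A → r u v → IsTight r k w u v by
    obtain ⟨w, h1, h2⟩ := h Finset.univ
    exact ⟨w, h1, fun u v => h2 u v (Finset.mem_univ _)⟩
  intro A
  induction A using Finset.induction_on with
  | empty =>
    -- Unit weights are feasible since `|C| ≤ k * |C|`.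
    refine ⟨fun _ _ => 1, fun u t _ => ?_, by simp⟩
    have h : ∀ (v : V) (p : List V), walkWeight (fun _ _ => 1) (v :: p) = p.length := by
      intro v p
      have := walkWeight_one_sub 0 (fun _ _ => 0) v p
      simpa using this
    rw [List.cons_append, h]
    have : (1 : ℤ) ≤ k := by exact_mod_cast hk
    simp only [List.length_append, List.length_singleton]
    push_cast
    nlinarith [(Nat.cast_nonneg t.length : (0 : ℤ) ≤ t.length)]
  | insert a A _ ih =>
    obtain ⟨w, h1, h2⟩ := ih
    by_cases ha : r a.1 a.2
    · obtain ⟨w', h3, h4, h5⟩ := h1.exists_isTight hk ha (hr _ _ ha)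
      refine ⟨w', h3, fun u v huv hr => ?_⟩
      rw [Finset.mem_insert] at huv
      obtain rfl | huv := huv
      · exact h5
      · exact (h2 u v huv hr).anti h4
    · refine ⟨w, h1, fun u v huv hr => ?_⟩
      rw [Finset.mem_insert] at huv
      obtain rfl | huv := huv
      · exact absurd hr ha
      · exact h2 u v huv hr

/-! ### Colouring by a potential modulo `k` -/

/-- The subdigraph of `r` induced by `S` has a proper colouring with `m` colours. -/
def ColorableOn (r : V → V → Prop) (S : Set V) (m : ℕ) : Prop :=
  ∃ c : V → ℕ, (∀ x ∈ S, c x < m) ∧ ∀ x ∈ S, ∀ y ∈ S, r x y → c x ≠ c y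

/-- If every arc lies on a closed walk and no directed circuit has length `1` modulo `k`, then
`k` colours suffice. -/
theorem colorableOn_univ_of_not_dvd [Finite V] {r : V → V → Prop} {k : ℕ} (hk : 0 < k)
    (hr : ∀ u v, r u v → Relation.ReflTransGen r v u)
    (hC : ∀ u t, IsCircuit r u t → ¬ k ∣ t.length) : ColorableOn r Set.univ k := by
  obtain ⟨w, hw, ht⟩ := exists_isFeasible_forall_isTight hk hr
  obtain ⟨f, hf⟩ := exists_potential (r := r) (g := fun x y => 1 - k * w x y) fun u t h => by
    have := hw u t h
    rw [List.cons_append] at this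
    rw [List.cons_append, walkWeight_one_sub]
    simp only [List.length_append, List.length_singleton]
    push_cast
    linarith
  have hk' : (0 : ℤ) < k := by exact_mod_cast hk
  refine ⟨fun v => (f v % k).toNat, fun v _ => ?_, fun u _ v _ huv heq => ?_⟩
  · have h1 := Int.emod_lt_of_pos (f v) hk'
    have h2 := Int.emod_nonneg (f v) hk'.ne'
    show (f v % k).toNat < k
    omega
  · have heq : f u % k = f v % k := by
      have h1 := Int.emod_nonneg (f v) hk'.ne'
      have h2 := Int.emod_nonneg (f u) hk'.ne'
      have : (f u % k).toNat = (f v % k).toNat := heq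
      omega
    obtain ⟨t, h1, h2, h3⟩ := ht u v huv
    have hlow := hf u v huv
    obtain ⟨q, hq⟩ := List.head?_eq_some_iff.1 h2
    have hlen : t.length = q.length := by simpa using congrArg List.length hq
    have hch := h1.2
    have hlast : (v :: q).getLast? = some u := by rw [← hq]; simp
    have hfe := hw u t h1
    rw [List.cons_append, hq] at hch h3 hfe
    have hup := add_walkWeight_le hf v u q hch.tail hlast
    rw [walkWeight_one_sub, ← hlen] at hup
    simp only [walkWeight] at h3 hfe
    set X := walkWeight w (v :: q)
    have hnd := hC u t h1
    have hd : (k : ℤ) ∣ f v - f u := Int.ModEq.dvd heq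
    obtain ⟨z, hz⟩ := hd
    -- Tightness reads `k * (w(C) - 1) ≤ |C| - 1`; the hypothesis on circuit lengths excludes
    -- equality.
    have h4 : (t.length : ℤ) ≠ k * (w u v + X - 1) := fun h =>
      hnd (Int.natCast_dvd_natCast.1 ⟨_, h⟩)
    have h5 : (k : ℤ) * (w u v + X - 1) + 1 ≤ t.length := by
      rcases lt_or_gt_of_ne h4 with h | h <;> linarith
    -- The multiple `f v - f u + k * w u v` of `k` is positive by the arc `u → v` and less than `k`
    -- by the rest of the tight circuit.
    have h6 : 0 < (k : ℤ) * (z + w u v) := by linarith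
    have h7 : (k : ℤ) * (z + w u v) < k * 1 := by linarith
    have h8 := pos_of_mul_pos_right h6 hk'.le
    have h9 := lt_of_mul_lt_mul_left h7 hk'.le
    omega

/-! ### Chords of a shortest long circuit -/

theorem reflTransGen_of_isChain {r : V → V → Prop} {x y : V} {l : List V}
    (h : List.IsChain r (x :: l)) (hy : y ∈ x :: l) : Relation.ReflTransGen r x y := by
  induction l generalizing x with
  | nil => simp_all [Relation.ReflTransGen.refl]
  | cons z l ih =>
    rw [List.isChain_cons_cons] at h
    rw [List.mem_cons] at hy
    obtain rfl | hy := hy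
    · exact .refl
    · exact .head h.1 (ih h.2 hy)

theorem IsCircuit.exists_rotate {r : V → V → Prop} {u x : V} {t : List V}
    (h : IsCircuit r u t) (hx : x ∈ u :: t) :
    ∃ t', IsCircuit r x t' ∧ (x :: t').Perm (u :: t) := by
  rw [List.mem_cons] at hx
  obtain rfl | hx := hx
  · exact ⟨t, h, .refl _⟩
  · obtain ⟨a, b, rfl⟩ := List.append_of_mem hx
    refine ⟨_, h.rotate, ?_⟩
    rw [← List.cons_append, ← List.cons_append]
    exact List.perm_append_comm

theorem IsCircuit.reflTransGen {r : V → V → Prop} {u x y : V} {t : List V}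
    (h : IsCircuit r u t) (hx : x ∈ u :: t) (hy : y ∈ u :: t) : Relation.ReflTransGen r x y := by
  obtain ⟨t', h', hp⟩ := h.exists_rotate hx
  have := h'.2
  rw [List.cons_append] at this
  exact reflTransGen_of_isChain this (List.mem_append_left [x] (hp.mem_iff.2 hy))

theorem IsCircuit.imp {r s : V → V → Prop} {u : V} {t : List V}
    (h : IsCircuit r u t) (hrs : ∀ x ∈ u :: t, ∀ y ∈ u :: t, r x y → s x y) :
    IsCircuit s u t := by
  refine ⟨h.1, h.2.imp_of_mem_imp fun x y hx hy hxy => hrs x ?_ y ?_ hxy⟩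
  · simp only [List.mem_append, List.mem_cons, List.not_mem_nil, or_false] at hx ⊢
    tauto
  · simp only [List.mem_append, List.mem_cons, List.not_mem_nil, or_false] at hy ⊢
    tauto

/-- Every vertex of a directed circuit is the tail of an arc. -/
theorem IsCircuit.exists_rel {r : V → V → Prop} {u x : V} {t : List V}
    (h : IsCircuit r u t) (hx : x ∈ u :: t) : ∃ y, r x y := by
  obtain ⟨t', h', -⟩ := h.exists_rotate hx
  cases t' with
  | nil => exact ⟨x, by simpa using h'.2⟩
  | cons y t' => exact ⟨y, by simpa using h'.2.rel⟩

theorem isCircuit_of_backward {r : V → V → Prop} {a b c : List V} {x y : V}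
    (hnd : (a ++ x :: b ++ y :: c).Nodup) (hch : List.IsChain r (a ++ x :: b ++ y :: c))
    (h : r y x) : IsCircuit r x (b ++ [y]) := by
  constructor
  · refine hnd.sublist ?_
    have e : a ++ x :: b ++ y :: c = a ++ (x :: (b ++ [y]) ++ c) := by simp
    rw [e]
    exact (List.sublist_append_left _ _).trans (List.sublist_append_right _ _)
  · have e : x :: (b ++ [y]) ++ [x] = (x :: b) ++ y :: [x] := by simp
    rw [e, List.isChain_split]
    exact ⟨hch.infix ⟨a, c, by simp⟩, by simpa using h⟩

/-- The chord `x → y` bypasses exactly the vertices of `b`. -/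
theorem isCircuit_of_forward {r : V → V → Prop} {u : V} {t a b c : List V} {x y : V}
    (hC : IsCircuit r u t) (e : u :: t = a ++ x :: b ++ y :: c) (h : r x y) :
    IsCircuit r y (c ++ a ++ [x]) := by
  obtain ⟨hnd, hch⟩ := hC
  have hlast : List.IsChain r (y :: c ++ [u]) := by
    refine hch.suffix ⟨a ++ x :: b, ?_⟩
    rw [e]
    simp
  have hfirst : List.IsChain r (a ++ [x]) := by
    refine hch.prefix ⟨b ++ y :: c ++ [u], ?_⟩
    rw [e]
    simp
  have hhead : (a ++ [x]).head? = some u := by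
    have := congrArg List.head? e
    cases a <;> simp_all
  obtain ⟨q, hq⟩ := List.head?_eq_some_iff.1 hhead
  constructor
  · rw [e] at hnd
    have hp : (a ++ x :: b ++ y :: c).Perm ((y :: (c ++ a ++ [x])) ++ b) := by
      classical
      rw [List.perm_iff_count]
      intro z
      simp only [List.count_append, List.count_cons, List.cons_append, List.count_nil]
      ring
    exact ((hp.nodup_iff).1 hnd).sublist (List.sublist_append_left _ _)
  · have e1 : y :: (c ++ a ++ [x]) ++ [y] = (y :: (c ++ a)) ++ x :: [y] := by simp
    rw [e1, List.isChain_split]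
    refine ⟨?_, by simpa using h⟩
    have e2 : y :: (c ++ a) ++ [x] = y :: c ++ (a ++ [x]) := by simp
    rw [e2, hq, List.isChain_split, ← hq]
    exact ⟨hlast, hfirst⟩

theorem exists_append_getElem (p : List V) {i j : ℕ} (hij : i < j) (hj : j < p.length) :
    ∃ a b c, p = a ++ p[i] :: b ++ p[j] :: c ∧ a.length = i ∧ b.length + i + 1 = j := by
  refine ⟨p.take i, (p.take j).drop (i + 1), p.drop (j + 1), ?_, ?_, ?_⟩
  · have h1 : p = p.take j ++ p[j] :: p.drop (j + 1) := by simp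
    have h2 : p.take j = (p.take j).take i ++ (p.take j).drop i :=
      (List.take_append_drop i _).symm
    have hi : i < (p.take j).length := by simp; omega
    rw [List.drop_eq_getElem_cons hi, List.take_take, min_eq_left hij.le, List.getElem_take] at h2
    rw [← h2]
    exact h1
  · simp; omega
  · simp; omega

/-- A digraph in which every arc lies on a closed walk and which is not `k`-colourable contains a
directed circuit with at least `k + 1` vertices inducing a `(k + 1)`-colourable subdigraph. -/
theorem exists_isCircuit_colorableOn [Finite V] {r : V → V → Prop} {k : ℕ} (hk : 2 ≤ k)
    (hirr : ∀ x, ¬ r x x) (hr : ∀ u v, r u v → Relation.ReflTransGen r v u)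
    (hcol : ¬ ColorableOn r Set.univ k) :
    ∃ u t, IsCircuit r u t ∧ k ≤ t.length ∧ ColorableOn r {x | x ∈ u :: t} (k + 1) := by
  classical
  -- Without loops, a circuit of length `1` modulo `k` has at least `k + 1` vertices.
  have hnil : ∀ (s : V → V → Prop), (∀ x, ¬ s x x) → ∀ u t, IsCircuit s u t → k ∣ t.length →
      k ≤ t.length := by
    intro s hs u t h hd
    refine Nat.le_of_dvd (Nat.pos_of_ne_zero fun h0 => ?_) hd
    obtain rfl := List.length_eq_zero_iff.1 h0
    exact hs u (by simpa using h.2)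
  have hex : ∃ m, ∃ u t, IsCircuit r u t ∧ k ≤ t.length ∧ t.length = m := by
    by_contra! h
    exact hcol (colorableOn_univ_of_not_dvd (by omega) hr fun u t hC hd =>
      h _ u t hC (hnil r hirr u t hC hd) rfl)
  obtain ⟨u, t, hC, hkt, hm⟩ := Nat.find_spec hex
  have hmin : ∀ u' t', IsCircuit r u' t' → k ≤ t'.length → t.length ≤ t'.length := by
    intro u' t' h1 h2
    rw [hm]
    exact Nat.find_min' hex ⟨u', t', h1, h2, rfl⟩
  clear hm
  refine ⟨u, t, hC, hkt, ?_⟩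
  set r' : V → V → Prop := fun x y => r x y ∧ x ∈ u :: t ∧ y ∈ u :: t with hr'
  have hC' : IsCircuit r' u t := hC.imp fun x hx y hy h => ⟨h, hx, hy⟩
  by_cases hcol' : ColorableOn r' Set.univ k
  · obtain ⟨c, h1, h2⟩ := hcol'
    exact ⟨c, fun x _ => (h1 x trivial).trans (Nat.lt_succ_self k),
      fun x hx y hy h => h2 x trivial y trivial ⟨h, hx, hy⟩⟩
  -- If `k` colours do not suffice on `C`, its vertices carry a circuit of length `1` modulo `k`; by
  -- minimality it has as many vertices as `C`.
  have hdvd : k ∣ t.length := by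
    by_contra hnd
    refine hcol' (colorableOn_univ_of_not_dvd (by omega)
      (fun x y h => hC'.reflTransGen h.2.2 h.2.1) fun u' t' h hd => hnd ?_)
    have h1 := hmin u' t' (h.imp fun _ _ _ _ hxy => hxy.1)
      (hnil r' (fun x hx => hirr x hx.1) u' t' h hd)
    have h2 : (u' :: t').length ≤ (u :: t).length := by
      refine (h.1.subperm fun x hx => ?_).length_le
      obtain ⟨y, hy⟩ := h.exists_rel hx
      exact hy.2.1
    simp only [List.length_cons] at h2
    have : t.length = t'.length := by omega
    rwa [this]
  obtain ⟨q, hq⟩ := hdvd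
  have hnd := hC.1
  have hch : List.IsChain r (u :: t) := hC.2.prefix ⟨[u], rfl⟩
  have hlen : (u :: t).length = t.length + 1 := rfl
  generalize hp : u :: t = p at *
  -- By minimality, the circuit closed by a chord is as long as `C` or has at most `k` vertices.
  have hback : ∀ i j (hij : i < j) (hj : j < p.length), r p[j] p[i] →
      j - i = t.length ∨ j - i < k := by
    intro i j hij hj h
    obtain ⟨a, b, c, h1, h2, h3⟩ := exists_append_getElem p hij hj
    have hc := isCircuit_of_backward (h1 ▸ hnd) (h1 ▸ hch) h
    have := hmin _ _ hc
    simp only [List.length_append, List.length_singleton] at this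
    omega
  have hforw : ∀ i j (hij : i < j) (hj : j < p.length), r p[i] p[j] →
      j = i + 1 ∨ t.length + i + 1 < k + j := by
    intro i j hij hj h
    obtain ⟨a, b, c, h1, h2, h3⟩ := exists_append_getElem p hij hj
    have hc := isCircuit_of_forward hC (hp.trans h1) h
    have := hmin _ _ hc
    have hl := congrArg List.length h1
    simp only [List.length_append, List.length_cons, List.length_nil] at this hl
    omega
  -- As `t.length = k * q`, positions congruent modulo `k` differ by at least `k` and at most
  -- `t.length - k`, too much or too little for any chord.
  have hne : ∀ i j, i < j → j < t.length → (∃ d, j = i + k * d) → k ≤ j - i ∧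
      ¬ (t.length + i + 1 < k + j) := by
    rintro i j hij hj ⟨d, hd⟩
    have hd0 : 0 < d := by
      rcases Nat.eq_zero_or_pos d with rfl | h
      · omega
      · exact h
    have hdq : d < q := by
      by_contra! h
      have := Nat.mul_le_mul_left k h
      omega
    have h1 : k * 1 ≤ k * d := Nat.mul_le_mul_left k hd0
    have h2 : k * (d + 1) ≤ k * q := Nat.mul_le_mul_left k hdq
    rw [mul_add] at h2
    omega
  have hmod : ∀ i j, i < j → i % k = j % k → ∃ d, j = i + k * d := by
    intro i j hij h
    obtain ⟨d, hd⟩ := (Nat.modEq_iff_dvd' hij.le).1 h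
    exact ⟨d, by omega⟩
  -- Colour by position modulo `k`, the last vertex getting the extra colour `k`.
  refine ⟨fun x => if p.idxOf x < t.length then p.idxOf x % k else k, fun x _ => ?_,
    fun x hx y hy hxy heq => ?_⟩
  · have := Nat.mod_lt (p.idxOf x) (show 0 < k by omega)
    dsimp only
    split_ifs <;> omega
  · have hi : p.idxOf x < p.length := List.idxOf_lt_length_iff.2 hx
    have hj : p.idxOf y < p.length := List.idxOf_lt_length_iff.2 hy
    have hxi : p[p.idxOf x] = x := List.getElem_idxOf hi
    have hyj : p[p.idxOf y] = y := List.getElem_idxOf hj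
    dsimp only at heq
    generalize p.idxOf x = i at *
    generalize p.idxOf y = j at *
    subst hxi hyj
    have hmi := Nat.mod_lt i (show 0 < k by omega)
    have hmj := Nat.mod_lt j (show 0 < k by omega)
    rcases lt_trichotomy i j with hij | rfl | hij
    · split_ifs at heq with h1 h2 h2
      · have h3 := hne i j hij h2 (hmod i j hij heq)
        have h4 := hforw i j hij hj hxy
        omega
      all_goals omega
    · exact hirr _ hxy
    · split_ifs at heq with h1 h2 h2
      · have h3 := hne j i hij h1 (hmod j i hij heq.symm)
        have h4 := hback j i hij hi hxy
        omega
      all_goals omega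

/-! ### Level functions and paths into a set -/

/-- A level function of an in-forest whose roots are the vertices of `S`. -/
def IsLevel (r : V → V → Prop) (S : Set V) (h : V → ℕ) : Prop :=
  (∀ x ∈ S, h x = 0) ∧ ∀ x ∉ S, ∃ y, r x y ∧ h x = h y + 1

theorem exists_isLevel {r : V → V → Prop} {S : Set V}
    (hr : ∀ x, ∃ y ∈ S, Relation.ReflTransGen r x y) : ∃ h, IsLevel r S h := by
  classical
  -- `R n x`: a walk of `n` arcs leads from `x` into `S`. The level is the distance to `S`.
  obtain ⟨R, hR0, hRs⟩ : ∃ R : ℕ → V → Prop, (∀ x, R 0 x ↔ x ∈ S) ∧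
      ∀ n x, R (n + 1) x ↔ ∃ y, r x y ∧ R n y :=
    ⟨fun n => Nat.rec (fun x => x ∈ S) (fun _ P x => ∃ y, r x y ∧ P y) n, fun _ => Iff.rfl,
      fun _ _ => Iff.rfl⟩
  have hR : ∀ x, ∃ n, R n x := by
    intro x
    obtain ⟨y, hy, hxy⟩ := hr x
    induction hxy using Relation.ReflTransGen.head_induction_on with
    | refl => exact ⟨0, (hR0 y).2 hy⟩
    | head h _ ih =>
      obtain ⟨n, hn⟩ := ih
      exact ⟨n + 1, (hRs _ _).2 ⟨_, h, hn⟩⟩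
  refine ⟨fun x => Nat.find (hR x), fun x hx => ?_, fun x hx => ?_⟩
  · exact (Nat.find_eq_zero (hR x)).2 ((hR0 x).2 hx)
  · have hs := Nat.find_spec (hR x)
    have hmin : ∀ m, R m x → Nat.find (hR x) ≤ m := fun m hm => Nat.find_min' (hR x) hm
    dsimp only
    generalize Nat.find (hR x) = n at hs hmin
    cases n with
    | zero => exact absurd ((hR0 x).1 hs) hx
    | succ n =>
      obtain ⟨y, hxy, hy⟩ := (hRs n x).1 hs
      have h1 : Nat.find (hR y) ≤ n := Nat.find_min' (hR y) hy
      have h2 := hmin _ ((hRs _ x).2 ⟨y, hxy, Nat.find_spec (hR y)⟩)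
      exact ⟨y, hxy, by omega⟩

theorem IsLevel.exists_path {r : V → V → Prop} {S : Set V} {h : V → ℕ} (hh : IsLevel r S h)
    (n : ℕ) (x : V) (hx : h x = n) :
    ∃ q s, q.length = n ∧ s ∈ S ∧ (q ++ [s]).Nodup ∧ List.IsChain r (q ++ [s]) ∧
      (q ++ [s]).head? = some x ∧ ∀ y ∈ q, y ∉ S ∧ h y ≤ n := by
  induction n generalizing x with
  | zero =>
    have : x ∈ S := by
      by_contra hS
      obtain ⟨y, -, hy⟩ := hh.2 x hS
      omega
    exact ⟨[], x, rfl, this, by simp, by simp, by simp, by simp⟩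
  | succ n ih =>
    have hS : x ∉ S := fun hS => by have := hh.1 x hS; omega
    obtain ⟨y, hxy, hy⟩ := hh.2 x hS
    obtain ⟨q, s, h1, h2, h3, h4, h5, h6⟩ := ih y (by omega)
    refine ⟨x :: q, s, by simp [h1], h2, ?_, ?_, by simp, ?_⟩
    · rw [List.cons_append, List.nodup_cons]
      refine ⟨fun hm => ?_, h3⟩
      rw [List.mem_append, List.mem_singleton] at hm
      obtain hm | rfl := hm
      · have := (h6 x hm).2
        omega
      · exact hS h2
    · rw [List.cons_append, List.isChain_cons]
      refine ⟨fun z hz => ?_, h4⟩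
      rw [h5] at hz
      simp only [Option.mem_def, Option.some.injEq] at hz
      exact hz ▸ hxy
    · intro z hz
      rw [List.mem_cons] at hz
      obtain rfl | hz := hz
      · exact ⟨hS, by omega⟩
      · exact ⟨(h6 z hz).1, (h6 z hz).2.trans n.le_succ⟩

/-- An arc between two vertices of the same level allows one to raise a level function. -/
theorem IsLevel.exists_raise {r : V → V → Prop} {S : Set V} {h : V → ℕ} (hh : IsLevel r S h)
    {u v : V} (huv : r u v) (hne : u ≠ v) (huS : u ∉ S) (heq : h u = h v) :
    ∃ h', IsLevel r S h' ∧ (∀ x, h x ≤ h' x) ∧ h u < h' u := by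
  classical
  have hpar : ∀ x, ∃ y, (x ∈ S → y = x) ∧ (x ∉ S → r x y ∧ h x = h y + 1) := by
    intro x
    by_cases hx : x ∈ S
    · exact ⟨x, fun _ => rfl, fun h => absurd hx h⟩
    · obtain ⟨y, hy⟩ := hh.2 x hx
      exact ⟨y, fun h => absurd h hx, fun _ => hy⟩
  choose π hS hπ using hpar
  have hdec : ∀ i x, x ≠ π^[i] x → h (π^[i] x) < h x := by
    intro i
    induction i with
    | zero => intro x hx; exact absurd rfl hx
    | succ i ih =>
      intro x hx
      rw [Function.iterate_succ_apply] at hx ⊢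
      by_cases hxS : x ∈ S
      · rw [hS x hxS] at hx ⊢
        exact ih x hx
      · have h1 := (hπ x hxS).2
        by_cases h2 : π x = π^[i] (π x)
        · rw [← h2]; omega
        · have := ih _ h2; omega
  -- Hang `u` below `v` instead: the subtree of `u` rises by one level, and `v` is not in it, being
  -- on the level of `u`.
  let desc : V → Prop := fun x => ∃ i, π^[i] x = u
  have hdu : desc u := ⟨0, rfl⟩
  have hdv : ¬ desc v := by
    rintro ⟨i, hi⟩
    have := hdec i v (by rw [hi]; exact hne.symm)
    rw [hi] at this
    omega
  have hdS : ∀ x ∈ S, ¬ desc x := by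
    rintro x hx ⟨i, hi⟩
    rw [Function.iterate_fixed (hS x hx)] at hi
    exact huS (hi ▸ hx)
  have hdπ : ∀ x, x ≠ u → (desc (π x) ↔ desc x) := by
    intro x hx
    constructor
    · rintro ⟨i, hi⟩
      exact ⟨i + 1, by rwa [Function.iterate_succ_apply]⟩
    · rintro ⟨i, hi⟩
      cases i with
      | zero => exact absurd hi hx
      | succ i => exact ⟨i, by rwa [Function.iterate_succ_apply] at hi⟩
  refine ⟨fun x => if desc x then h x + 1 else h x, ⟨fun x hx => ?_, fun x hx => ?_⟩,
    fun x => ?_, ?_⟩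
  · simp only [if_neg (hdS x hx), hh.1 x hx]
  · by_cases hxu : x = u
    · subst hxu
      exact ⟨v, huv, by simp only [if_pos hdu, if_neg hdv, heq]⟩
    · refine ⟨π x, (hπ x hx).1, ?_⟩
      have := (hπ x hx).2
      simp only [hdπ x hxu]
      split_ifs <;> omega
  · dsimp only
    split_ifs <;> omega
  · simp only [if_pos hdu]
    omega

/-- If every vertex reaches `S`, then there is a path of length `l` meeting `S` exactly in its
final vertex, or the complement of `S` is `(l - 1)`-colourable. -/
theorem exists_path_or_colorableOn [Finite V] {r : V → V → Prop} {S : Set V}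
    (hirr : ∀ x, ¬ r x x) (hr : ∀ x, ∃ y ∈ S, Relation.ReflTransGen r x y) {l : ℕ} :
    (∃ q s, q.length = l ∧ s ∈ S ∧ (q ++ [s]).Nodup ∧ List.IsChain r (q ++ [s]) ∧
      ∀ y ∈ q, y ∉ S) ∨ ColorableOn r Sᶜ (l - 1) := by
  classical
  have := Fintype.ofFinite V
  by_cases hl : ∃ h x, IsLevel r S h ∧ l ≤ h x
  · left
    obtain ⟨h, x, hh, hx⟩ := hl
    obtain ⟨q, s, h1, h2, h3, h4, -, h6⟩ := hh.exists_path _ x rfl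
    have hs : q.drop (h x - l) ++ [s] <:+ q ++ [s] :=
      ⟨q.take (h x - l), by rw [← List.append_assoc, List.take_append_drop]⟩
    refine ⟨q.drop (h x - l), s, ?_, h2, h3.sublist hs.sublist, h4.suffix hs,
      fun y hy => (h6 y (List.mem_of_mem_drop hy)).1⟩
    rw [List.length_drop]
    omega
  · right
    push Not at hl
    have hfin : {h | IsLevel r S h}.Finite := by
      refine (Set.Finite.pi' (t := fun _ : V => Set.Iio l) fun _ => Set.finite_Iio l).subset ?_
      exact fun h hh x => hl h x hh
    -- With maximal sum no raise is possible, so no arc outside `S` joins equal levels; these levels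
    -- are `1, …, l - 1`.
    obtain ⟨h, hh, hmax⟩ := Set.exists_max_image _ (fun h : V → ℕ => ∑ x, h x) hfin
      (exists_isLevel hr)
    have hh : IsLevel r S h := hh
    refine ⟨fun x => h x - 1, fun x hx => ?_, fun x hx y hy hxy heq => ?_⟩
    · have h1 := hl h x hh
      obtain ⟨y, -, h2⟩ := hh.2 x hx
      show h x - 1 < l - 1
      omega
    · have heq : h x - 1 = h y - 1 := heq
      obtain ⟨x', -, h1⟩ := hh.2 x hx
      obtain ⟨y', -, h2⟩ := hh.2 y hy
      obtain ⟨h', h3, h4, h5⟩ := hh.exists_raise hxy (fun e => hirr y (e ▸ hxy)) hx (by omega)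
      have := Finset.sum_lt_sum (s := Finset.univ) (fun z _ => h4 z) ⟨x, Finset.mem_univ x, h5⟩
      exact absurd (hmax h' h3) (not_le.2 this)

/-! ### Joining the circuit and the path -/

theorem ColorableOn.mono {r : V → V → Prop} {S : Set V} {m n : ℕ} (hmn : m ≤ n)
    (h : ColorableOn r S m) : ColorableOn r S n := by
  obtain ⟨c, h1, h2⟩ := h
  exact ⟨c, fun x hx => (h1 x hx).trans_le hmn, h2⟩

theorem ColorableOn.univ_of_compl {r : V → V → Prop} {S : Set V} {m n : ℕ}
    (h : ColorableOn r S m) (h' : ColorableOn r Sᶜ n) : ColorableOn r Set.univ (m + n) := by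
  classical
  obtain ⟨c, h1, h2⟩ := h
  obtain ⟨c', h3, h4⟩ := h'
  refine ⟨fun x => if x ∈ S then c x else m + c' x, fun x _ => ?_, fun x _ y _ hxy => ?_⟩
  · dsimp only
    split_ifs with hx
    · have := h1 x hx
      omega
    · have := h3 x hx
      omega
  · dsimp only
    split_ifs with hx hy hy
    · exact h2 x hx y hy hxy
    · have := h1 x hx
      omega
    · have := h1 y hy
      omega
    · have := h4 x hx y hy hxy
      omega

/-- A strongly connected digraph which is not `(k + l)`-colourable contains two directed paths of
lengths `k` and `l` meeting exactly in their common final vertex. -/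
theorem exists_two_paths [Finite V] {r : V → V → Prop} {k l : ℕ} (hk : 2 ≤ k)
    (hirr : ∀ x, ¬ r x x) (hr : ∀ x y, Relation.ReflTransGen r x y)
    (hcol : ¬ ColorableOn r Set.univ (k + l)) :
    ∃ p s q, p.length = k ∧ q.length = l ∧ (p ++ s :: q).Nodup ∧ List.IsChain r (p ++ [s]) ∧
      List.IsChain r (q ++ [s]) := by
  obtain ⟨u, t, hC, hkt, hS⟩ := exists_isCircuit_colorableOn hk hirr (fun u v _ => hr v u)
    fun h => hcol (h.mono (Nat.le_add_right k l))
  set S : Set V := {x | x ∈ u :: t} with hSdef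
  have huS : u ∈ S := by simp [hSdef]
  have hpath : ∃ q s, q.length = l ∧ s ∈ S ∧ (q ++ [s]).Nodup ∧ List.IsChain r (q ++ [s]) ∧
      ∀ y ∈ q, y ∉ S := by
    -- For `l = 0` the truncated `l - 1` would spoil the count `k + l = k + 1 + (l - 1)`.
    rcases Nat.eq_zero_or_pos l with rfl | hl
    · exact ⟨[], u, by simp [huS]⟩
    · refine (exists_path_or_colorableOn hirr fun x => ⟨u, huS, hr x u⟩).resolve_right fun h => ?_
      refine hcol ?_
      have e : k + l = k + 1 + (l - 1) := by omega
      rw [e]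
      exact hS.univ_of_compl h
  obtain ⟨q, s, hq, hs, hnd, hch, hqS⟩ := hpath
  obtain ⟨t', hC', hperm⟩ := hC.exists_rotate hs
  have hlen : t'.length = t.length := by simpa using hperm.length_eq
  have hsub : ∀ x ∈ t'.drop (t'.length - k), x ∈ t' := fun x hx => List.mem_of_mem_drop hx
  -- The first block consists of the last `k` vertices of the circuit before it returns to `s`.
  refine ⟨t'.drop (t'.length - k), s, q, by simp; omega, hq, ?_, ?_, hch⟩
  · refine List.Nodup.append ((List.nodup_cons.1 hC'.1).2.sublist (List.drop_sublist _ _))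
      ((List.perm_append_singleton s q).nodup_iff.1 hnd) fun x hx hxq => ?_
    have hx := hsub x hx
    rw [List.mem_cons] at hxq
    obtain rfl | hxq := hxq
    · exact (List.nodup_cons.1 hC'.1).1 hx
    · exact hqS x hxq (hperm.mem_iff.1 (List.mem_cons_of_mem _ hx))
  · refine hC'.2.suffix ⟨s :: t'.take (t'.length - k), ?_⟩
    rw [← List.append_assoc, List.cons_append, List.take_append_drop]

theorem contains_twoBlockPath {D : Digraph V} {k l : ℕ} {p q : List V} {s : V}
    (hp : p.length = k) (hq : q.length = l) (hnd : (p ++ s :: q).Nodup)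
    (hchp : List.IsChain D.Adj (p ++ [s])) (hchq : List.IsChain D.Adj (q ++ [s])) :
    D.Contains (twoBlockPath k l) := by
  have hnd' : (p ++ s :: q.reverse).Nodup := by
    refine (List.Perm.nodup_iff ?_).1 hnd
    exact List.Perm.append_left p ((List.reverse_perm q).symm.cons s)
  have hrev : List.IsChain (fun a b => D.Adj b a) (s :: q.reverse) := by
    have : (q ++ [s]).reverse = s :: q.reverse := by simp
    rw [← this, List.isChain_reverse]
    exact hchq
  rw [List.isChain_iff_getElem] at hchp hrev
  have hlen : (p ++ s :: q.reverse).length = k + l + 1 := by simp; omega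
  refine ⟨fun i => (p ++ s :: q.reverse)[(i : ℕ)]'(by omega), fun i j hij => ?_, ?_⟩
  · exact Fin.ext ((List.Nodup.getElem_inj_iff hnd').1 hij)
  · rintro ⟨i, hi⟩ ⟨j, hj⟩ (⟨h1, h2⟩ | ⟨h1, h2⟩)
    · dsimp only at h1 h2 ⊢
      subst h1
      have e : p ++ s :: q.reverse = (p ++ [s]) ++ q.reverse := by simp
      have h := hchp i (by simp; omega)
      simp only [e]
      have hget : ∀ m (hm : m < (p ++ [s]).length),
          ((p ++ [s]) ++ q.reverse)[m]'(by rw [List.length_append]; omega) = (p ++ [s])[m] :=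
        fun m hm => List.getElem_append_left hm
      rw [hget, hget]
      exact h
    · dsimp only at h1 h2 ⊢
      subst h1
      have h := hrev (j - k) (by simp; omega)
      rw [List.getElem_append_right (by omega), List.getElem_append_right (by omega)]
      simp only [hp]
      have e : j + 1 - k = j - k + 1 := by omega
      simp only [e]
      exact h

theorem Contains.trans {U W : Type*} {D : Digraph V} {E : Digraph U} {F : Digraph W}
    (h : D.Contains E) (h' : E.Contains F) : D.Contains F := by
  obtain ⟨f, hf, hf'⟩ := h
  obtain ⟨g, hg, hg'⟩ := h'
  exact ⟨f ∘ g, hf.comp hg, fun x y hxy => hf' _ _ (hg' _ _ hxy)⟩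

theorem twoBlockPath_contains_swap (k l : ℕ) :
    (twoBlockPath k l).Contains (twoBlockPath l k) := by
  refine ⟨fun i => ⟨k + l - i, by omega⟩, fun i j hij => ?_, ?_⟩
  · simp only [Fin.mk.injEq] at hij
    ext
    omega
  · rintro ⟨i, hi⟩ ⟨j, hj⟩ h
    simp only [twoBlockPath] at h ⊢
    omega

theorem contains_twoBlockPath_of_finite [Finite V] {D : Digraph V} {k l : ℕ}
    (hkl : 3 ≤ k + l) (hirr : ∀ x, ¬ D.Adj x x) (hr : D.IsStronglyConnected)
    (hcol : ¬ ColorableOn D.Adj Set.univ (k + l)) : D.Contains (twoBlockPath k l) := by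
  rcases le_total l k with h | h
  · obtain ⟨p, s, q, h1, h2, h3, h4, h5⟩ := exists_two_paths (by omega) hirr hr hcol
    exact contains_twoBlockPath h1 h2 h3 h4 h5
  · rw [add_comm] at hcol
    obtain ⟨p, s, q, h1, h2, h3, h4, h5⟩ := exists_two_paths (by omega) hirr hr hcol
    exact (contains_twoBlockPath h1 h2 h3 h4 h5).trans (twoBlockPath_contains_swap l k)

/-! ### Reduction to finite digraphs -/

/-- The subdigraph induced by a set of vertices. -/
def inducedOn (D : Digraph V) (T : Set V) : Digraph T where
  Adj x y := D.Adj x y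

theorem inducedOn_reflTransGen_mono {D : Digraph V} {T T' : Set V} (h : T ⊆ T') {x y : T}
    (hxy : Relation.ReflTransGen (D.inducedOn T).Adj x y) :
    Relation.ReflTransGen (D.inducedOn T').Adj ⟨x, h x.2⟩ ⟨y, h y.2⟩ :=
  hxy.lift (fun z : T => (⟨z, h z.2⟩ : T')) fun _ _ hab => hab

/-- A finite set of vertices through which `y` is reached from `x`. -/
theorem exists_finite_walk {D : Digraph V} {x y : V} (h : Relation.ReflTransGen D.Adj x y) :
    ∃ P : Set V, P.Finite ∧ ∃ hx : x ∈ P, ∃ hy : y ∈ P, ∀ z : P,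
      Relation.ReflTransGen (D.inducedOn P).Adj ⟨x, hx⟩ z ∧
      Relation.ReflTransGen (D.inducedOn P).Adj z ⟨y, hy⟩ := by
  induction h with
  | refl =>
    refine ⟨{x}, Set.finite_singleton x, rfl, rfl, ?_⟩
    rintro ⟨z, rfl⟩
    exact ⟨.refl, .refl⟩
  | @tail b c _ hbc ih =>
    obtain ⟨P, hP, hx, hb, hz⟩ := ih
    have hsub : P ⊆ insert c P := Set.subset_insert c P
    have hbc' : (D.inducedOn (insert c P)).Adj ⟨b, hsub hb⟩ ⟨c, Set.mem_insert c P⟩ := hbc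
    refine ⟨insert c P, hP.insert c, hsub hx, Set.mem_insert c P, ?_⟩
    rintro ⟨z, rfl | hzP⟩
    · exact ⟨(inducedOn_reflTransGen_mono hsub (hz ⟨b, hb⟩).1).tail hbc', .refl⟩
    · exact ⟨inducedOn_reflTransGen_mono hsub (hz ⟨z, hzP⟩).1,
        (inducedOn_reflTransGen_mono hsub (hz ⟨z, hzP⟩).2).tail hbc'⟩

/-- In a strongly connected digraph, every finite set of vertices is contained in a finite set
inducing a strongly connected subdigraph. -/
theorem IsStronglyConnected.exists_finite {D : Digraph V} (hD : D.IsStronglyConnected)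
    {A : Set V} (hA : A.Finite) :
    ∃ T : Set V, T.Finite ∧ A ⊆ T ∧ (D.inducedOn T).IsStronglyConnected := by
  -- The union of the walks over all pairs from `A` works: from any of its vertices follow a walk to
  -- its end in `A`, cross to the start of another walk, and follow that.
  choose P hfin hx hy hz using fun x y => exists_finite_walk (hD x y)
  have hsub : ∀ x ∈ A, ∀ y ∈ A, P x y ⊆ ⋃ x ∈ A, ⋃ y ∈ A, P x y := fun x hxA y hyA z hz =>
    Set.mem_biUnion hxA (Set.mem_biUnion hyA hz)
  refine ⟨⋃ x ∈ A, ⋃ y ∈ A, P x y, hA.biUnion fun x _ => hA.biUnion fun y _ => hfin x y,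
    fun x hxA => hsub x hxA x hxA (hx x x), ?_⟩
  rintro ⟨a, ha⟩ ⟨b, hb⟩
  simp only [Set.mem_iUnion, exists_prop] at ha hb
  obtain ⟨x, hxA, y, hyA, haP⟩ := ha
  obtain ⟨x', hxA', y', hyA', hbP⟩ := hb
  have h1 := inducedOn_reflTransGen_mono (hsub x hxA y hyA) (hz x y ⟨a, haP⟩).2
  have h2 := inducedOn_reflTransGen_mono (hsub y hyA x' hxA') (hz y x' ⟨y, hx y x'⟩).2
  have h3 := inducedOn_reflTransGen_mono (hsub x' hxA' y' hyA') (hz x' y' ⟨b, hbP⟩).1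
  exact (h1.trans h2).trans h3

theorem ColorableOn.colorable {r : V → V → Prop} {m : ℕ} (h : ColorableOn r Set.univ m) :
    (SimpleGraph.fromRel r).Colorable m := by
  obtain ⟨c, h1, h2⟩ := h
  refine ⟨SimpleGraph.Coloring.mk (fun x => (⟨c x, h1 x trivial⟩ : Fin m)) fun {x y} hxy => ?_⟩
  rw [SimpleGraph.fromRel_adj] at hxy
  intro heq
  rw [Fin.mk.injEq] at heq
  obtain ⟨-, h | h⟩ := hxy
  · exact h2 x trivial y trivial h heq
  · exact h2 y trivial x trivial h heq.symm

/-- De Bruijn–Erdős compactness. All supersets of `A` are allowed, so that `A` can be enlarged to a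
strongly connected set. -/
theorem exists_finite_not_colorableOn {D : Digraph V} {m : ℕ}
    (h : ¬ D.toSimpleGraphInclusive.Colorable m) :
    ∃ A : Set V, A.Finite ∧ ∀ T : Set V, A ⊆ T →
      ¬ ColorableOn (D.inducedOn T).Adj Set.univ m := by
  by_contra! hcon
  refine h (SimpleGraph.nonempty_hom_of_forall_finite_subgraph_hom fun G' hG' =>
    Classical.choice ?_)
  obtain ⟨T, hT, hc⟩ := hcon G'.verts hG'
  obtain ⟨c⟩ := hc.colorable
  refine ⟨⟨fun x => c ⟨x, hT x.2⟩, fun {x y} hxy => c.valid ?_⟩⟩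
  have h1 := G'.adj_sub hxy
  simp only [toSimpleGraphInclusive, SimpleGraph.fromRel_adj] at h1 ⊢
  exact ⟨fun e => h1.1 (congrArg (fun z : T => (z : V)) e), h1.2⟩

theorem inducedOn_contained (D : Digraph V) (T : Set V) : D.Contains (D.inducedOn T) :=
  ⟨Subtype.val, Subtype.val_injective, fun _ _ h => h⟩

end Digraph

theorem corollary3p5 {V : Type*} (D : Digraph V) (n k l : ℕ) (hn : 4 ≤ n)
    (hkl : k + l = n - 1) (hD : D.IsOriented) (hconn : D.IsStronglyConnected)
    (hchi : D.chromaticNumber = (n : ℕ∞)) :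
    D.Contains (Digraph.twoBlockPath k l) := by
  have hcol : ¬ D.toSimpleGraphInclusive.Colorable (k + l) := fun h => by
    have h1 : D.chromaticNumber ≤ ((k + l : ℕ) : ℕ∞) := h.chromaticNumber_le
    rw [hchi, Nat.cast_le] at h1
    omega
  obtain ⟨A, hA, hAcol⟩ := Digraph.exists_finite_not_colorableOn hcol
  obtain ⟨T, hT, hAT, hconnT⟩ := hconn.exists_finite hA
  have := hT.to_subtype
  exact (D.inducedOn_contained T).trans (Digraph.contains_twoBlockPath_of_finite (by omega)
    (fun x h => hD x x h h) hconnT (hAcol T hAT))
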